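/- **Setting.** Fix $\varepsilon\in(0,1/2)$ and a function $\chi:[0,\infty)\to[0,\infty)$ with $\chi(x)\to0$ as $x\to\infty$. On a probability space $(\Omega,\mathcal F,\mathbb P)$ let $(\xi_i)_{i\ge1}$ be i.i.d. real random variables with $\mathbb P[\varepsilon\le\xi_1\le1-\varepsilon]=1$ and let $(Y_i)_{i\ge1}$ be i.i.d. random variables with values in $[-1,1]$, such that $(Y_i)_{i\in S}$ and $(\xi_j)_{j\in T}$ are independent whenever $S,T\subset\{1,2,\dots\}$ are finite and disjoint ($Y_i$ may depend on $\xi_i$). For $n\ge1$ let $p_n$ be $\xi_n+Y_n\chi(n)$ truncated to $[\varepsilon/2,1-\varepsilon/2]$, i.e. $p_n=\xi_n+Y_n\chi(n)$ if this number lies in $[\varepsilon/2,1-\varepsilon/2]$, $p_n=\varepsilon/2$ if it is smaller than $\varepsilon/2$, and $p_n=1-\varepsilon/2$ if it is larger than $1-\varepsilon/2$; put $q_n=1-p_n$. A realization $\omega$ of $(p_n,q_n)_{n\ge1}$ is an environment. Given $\omega$, let $(\eta_t(\omega))_{t\ge0}$ be the Markov chain on $\{0,1,2,\dots\}$ which from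 $n\ge1$ moves to $n-1$ with probability $p_n$ and to $n+1$ with probability $q_n$, and from $0$ moves to $0$ or $1$ with probability $1/2$ each. The chain is called *transient* if, for every state $x$, started at $x$ it returns to $x$ with probability less than $1$; *null-recurrent* if, for every state $x$, started at $x$ it returns to $x$ with probability $1$ and the expected return time is infinite; *ergodic* (positive recurrent) if, for every state $x$, started at $x$ it returns to $x$ with probability $1$ and the expected return time is finite. **Theorem.** Suppose $\mathbb P[\xi_1=c]=1$ for some $c\in(0,1)$, and $\operatorname{Var}[Y_1]>0$. (i) If $c<1/2$, then $\eta_t(\omega)$ is transient for $\mathbb P$-a.e. $\omega$. (ii) If $c>1/2$, then $\eta_t(\omega)$ is ergodic for $\mathbb P$-a.e. $\omega$. (iii) If $c=1/2$ and $Y_1$ has the same distribution as $-Y_1$, then $\eta_t(\omega)$ is null-recurrent for $\mathbb P$-a.e. $\omega$. (iv) Suppose $c=1/2$, $\mathbb E[Y_1]\ne0$, and $\chi(n)=an^{-\beta}$ for all integers $n\ge1$, where $a>0$ and $\beta>0$. (a) If $0<\beta<1$ and $\mathbb E[Y_1]>0$, then $\eta_t(\omega)$ is ergodic for $\mathbb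 P$-a.e. $\omega$. (b) If $\beta>1$, then $\eta_t(\omega)$ is null-recurrent for $\mathbb P$-a.e. $\omega$. (c) If $0<\beta<1$ and $\mathbb E[Y_1]<0$, then $\eta_t(\omega)$ is transient for $\mathbb P$-a.e. $\omega$. -/

import Mathlib

open MeasureTheory ProbabilityTheory Filter Topology
open scoped NNReal ENNReal

noncomputable section

namespace RWRE

/-! ### Time-homogeneous Markov chains on `ℕ` and their classification -/

/-- The law on path space `ℕ → ℕ` of the time-homogeneous Markov chain with one-step transition
kernel `P`, started at the state `x`. -/
def chainLaw (P : Kernel ℕ ℕ) [IsMarkovKernel P] (x : ℕ) : Measure (ℕ → ℕ) :=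
  Kernel.trajMeasure (X := fun _ => ℕ) (Measure.dirac x)
    (fun n => P.comap (fun h : (i : Finset.Iic n) → ℕ => h ⟨n, Finset.mem_Iic.2 le_rfl⟩)
      (measurable_pi_apply _))

/-- The first time `t ≥ 1` at which the path `η` is at `x` (`∞` if there is none). -/
def returnTime (x : ℕ) (η : ℕ → ℕ) : ℝ≥0∞ :=
  ⨅ (t : ℕ) (_ : 1 ≤ t ∧ η t = x), (t : ℝ≥0∞)

/-- The state `x` is recurrent: started at `x`, the chain returns to `x` almost surely. -/
def IsRecurrentState (P : Kernel ℕ ℕ) [IsMarkovKernel P] (x : ℕ) : Prop :=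
  ∀ᵐ η ∂(chainLaw P x), returnTime x η < ∞

/-- The expected return time to `x` of the chain started at `x`. -/
def meanReturnTime (P : Kernel ℕ ℕ) [IsMarkovKernel P] (x : ℕ) : ℝ≥0∞ :=
  ∫⁻ η, returnTime x η ∂(chainLaw P x)

/-- The chain is transient: no state is recurrent. -/
def IsTransient (P : Kernel ℕ ℕ) [IsMarkovKernel P] : Prop :=
  ∀ x, ¬ IsRecurrentState P x

/-- The chain is null-recurrent: every state is recurrent, with infinite mean return time. -/
def IsNullRecurrent (P : Kernel ℕ ℕ) [IsMarkovKernel P] : Prop :=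
  ∀ x, IsRecurrentState P x ∧ meanReturnTime P x = ∞

/-- The chain is ergodic, i.e. positive recurrent: every state is recurrent, with finite mean
return time. -/
def IsErgodic (P : Kernel ℕ ℕ) [IsMarkovKernel P] : Prop :=
  ∀ x, IsRecurrentState P x ∧ meanReturnTime P x < ∞

/-! ### The environment -/

/-- `x` truncated to `[ε / 2, 1 - ε / 2]`. -/
def truncate (ε x : ℝ) : ℝ :=
  if x < ε / 2 then ε / 2 else if 1 - ε / 2 < x then 1 - ε / 2 else x

lemma truncate_mem {ε : ℝ} (hε : ε ∈ Set.Ioo (0 : ℝ) (1 / 2)) (x : ℝ) :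
    truncate ε x ∈ Set.Icc (ε / 2) (1 - ε / 2) := by
  obtain ⟨h0, h1⟩ := hε
  unfold truncate
  split_ifs with h h' <;> constructor <;> linarith

/-- The environment built from realizations `ξ`, `Y` of the two sequences: `p n` is
`ξ n + Y n * χ n`, truncated to `[ε / 2, 1 - ε / 2]`. -/
def environment {ε : ℝ} (hε : ε ∈ Set.Ioo (0 : ℝ) (1 / 2)) (χ : ℝ≥0 → ℝ≥0) (ξ Y : ℕ+ → ℝ) :
    ℕ+ → unitInterval :=
  fun n => ⟨truncate ε (ξ n + Y n * χ (n : ℕ)), by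
    have h := truncate_mem hε (ξ n + Y n * χ (n : ℕ))
    exact ⟨by linarith [h.1, hε.1], by linarith [h.2, hε.1]⟩⟩

/-- The one-step transition law out of a state in the environment `p`: from `0` the walk moves to
`0` or `1` with probability `1 / 2` each; from `n ≥ 1` it moves to `n - 1` with probability `p n`
and to `n + 1` with probability `1 - p n`. -/
def step (p : ℕ+ → unitInterval) : ℕ → Measure ℕ
  | 0 => (1 / 2 : ℝ≥0∞) • Measure.dirac 0 + (1 / 2 : ℝ≥0∞) • Measure.dirac 1
  | k + 1 => ENNReal.ofReal (p k.succPNat) • Measure.dirac k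
      + ENNReal.ofReal (1 - p k.succPNat) • Measure.dirac (k + 2)

/-- The (quenched) one-step transition kernel of the walk in the environment `p`. -/
def walkKernel (p : ℕ+ → unitInterval) : Kernel ℕ ℕ := Kernel.ofFunOfCountable (step p)

instance (p : ℕ+ → unitInterval) : IsMarkovKernel (walkKernel p) := by
  refine ⟨fun n => ⟨?_⟩⟩
  change step p n Set.univ = 1
  cases n with
  | zero => simp [step, ENNReal.inv_two_add_inv_two]
  | succ k =>
    simp only [step, Measure.add_apply, Measure.smul_apply, measure_univ, smul_eq_mul, mul_one]
    rw [← ENNReal.ofReal_add (p k.succPNat).2.1 (by linarith [(p k.succPNat).2.2])]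
    simp

end RWRE

end

noncomputable section

namespace RWRE

/-! ### First passage probabilities of Markov chains on `ℕ` -/

/-! Since `ξ` is almost surely the constant `c`, the environment is `c + Y n * χ n`, truncated.
Write `r n` for the product of the ratios `p k / q k` over the states `1, …, n`. For a fixed
environment the partial sums of `r` form the scale function, and `1 / r` gives the edge weights of
the reversible measure. Hence the walk is transient if `∑ r n` converges, ergodic if `∑ 1 / r n`
converges, and null-recurrent if neither does (`isTransient_walkKernel`, `isErgodic_walkKernel`,
`isNullRecurrent_walkKernel`).

It remains to decide these two convergences almost surely. Replacing each `p` by `1 - p` turns `r`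
into `1 / r`, so every estimate is needed for one series only. For `c ≠ 1 / 2` the ratio test
decides (`summable_ratioProd_of_tendsto`). For `c = 1 / 2` and symmetric `Y`, the convergence of `∑
r n` is a tail event, disjoint from its mirror image and of equal probability; by Kolmogorov's
zero-one law both are null (`ae_not_summable_ratioProd`). For `χ n = a * n ^ (-β)` with `β > 1` the
drift is summable, so `r` stays bounded away from `0` and `∞` (`not_summable_ratioProd`). With `β <
1` the mean drift eventually exceeds `1 / k`; by independence the mean of `r n` (or of `1 / r n`,
according to the sign of the mean of `Y`) past a fixed index is `O(n ^ (-2))`, so the series has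
finite mean (`ae_summable_ratioProd`). -/

/-- The transition operator of the chain killed when it jumps to `x`. -/
def killed (P : Kernel ℕ ℕ) (x : ℕ) (f : ℕ → ℝ≥0∞) (y : ℕ) : ℝ≥0∞ :=
  ∫⁻ z, (if z = x then 0 else f z) ∂(P y)

/-- The probability that the chain started at `y` does not visit `x` at times `1, …, t`. -/
def avoid (P : Kernel ℕ ℕ) (x t : ℕ) : ℕ → ℝ≥0∞ := (killed P x)^[t] 1

/-- The set of paths which do not visit `x` at times `1, …, t`. -/
def avoidSet (x t : ℕ) : Set (ℕ → ℕ) := {η | ∀ s, 1 ≤ s → s ≤ t → η s ≠ x}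

lemma avoid_zero (P : Kernel ℕ ℕ) (x : ℕ) : avoid P x 0 = 1 := rfl

lemma avoid_succ (P : Kernel ℕ ℕ) (x t : ℕ) : avoid P x (t + 1) = killed P x (avoid P x t) :=
  Function.iterate_succ_apply' _ _ _

instance (P : Kernel ℕ ℕ) [IsMarkovKernel P] (x : ℕ) : IsProbabilityMeasure (chainLaw P x) := by
  unfold chainLaw; infer_instance

lemma lintegral_chainLaw_zero (P : Kernel ℕ ℕ) [IsMarkovKernel P] (y : ℕ) (g : ℕ → ℝ≥0∞) :
    ∫⁻ η, g (η 0) ∂(chainLaw P y) = g y := by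
  set κ : (n : ℕ) → Kernel ((i : Finset.Iic n) → ℕ) ℕ := fun n =>
    P.comap (fun h : (i : Finset.Iic n) → ℕ => h ⟨n, Finset.mem_Iic.2 le_rfl⟩)
      (measurable_pi_apply _)
  set h₀ : (i : Finset.Iic 0) → ℕ :=
    (MeasurableEquiv.piUnique (fun _ : Finset.Iic 0 => ℕ)).symm y with hh₀
  have h1 : chainLaw P y = Kernel.traj (X := fun _ => ℕ) κ 0 h₀ := by
    change (Kernel.traj (X := fun _ => ℕ) κ 0) ∘ₘ ((Measure.dirac y).map _) = _
    rw [Measure.map_dirac' (MeasurableEquiv.measurable _), Measure.dirac_bind (Kernel.measurable _)]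
  have h2 := Kernel.traj_map_frestrictLe_apply (X := fun _ => ℕ) (κ := κ) 0 0 h₀
  rw [Kernel.partialTraj_self, Kernel.id_apply, ← h1] at h2
  have hm : Measurable fun h : (i : Finset.Iic 0) → ℕ => g (h ⟨0, by simp⟩) :=
    (measurable_of_countable g).comp (measurable_pi_apply _)
  have h3 := lintegral_map (μ := chainLaw P y) hm (Preorder.measurable_frestrictLe 0)
  rw [h2, lintegral_dirac' _ hm] at h3
  exact h3.symm

/-- The Markov property at time `n`: the joint law of the past and the next state is the
composition-product of the law of the past with the transition kernel. -/
lemma lintegral_chainLaw_succ (P : Kernel ℕ ℕ) [IsMarkovKernel P] (y n : ℕ)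
    (G : ((i : Finset.Iic n) → ℕ) → ℝ≥0∞) (hG : Measurable G) (f : ℕ → ℝ≥0∞) :
    ∫⁻ η, G (Preorder.frestrictLe n η) * f (η (n + 1)) ∂(chainLaw P y) =
      ∫⁻ η, G (Preorder.frestrictLe n η) * ∫⁻ z, f z ∂(P (η n)) ∂(chainLaw P y) := by
  have hf : Measurable f := measurable_of_countable f
  set κ : (n : ℕ) → Kernel ((i : Finset.Iic n) → ℕ) ℕ := fun n =>
    P.comap (fun h : (i : Finset.Iic n) → ℕ => h ⟨n, Finset.mem_Iic.2 le_rfl⟩)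
      (measurable_pi_apply _) with hκ
  have key := Kernel.map_frestrictLe_trajMeasure_compProd_eq_map_trajMeasure
    (X := fun _ => ℕ) (μ₀ := Measure.dirac y) (κ := κ) (a := n)
  change (chainLaw P y).map _ ⊗ₘ κ n = (chainLaw P y).map _ at key
  have hm : Measurable fun q : ((i : Finset.Iic n) → ℕ) × ℕ => G q.1 * f q.2 :=
    (hG.comp measurable_fst).mul (hf.comp measurable_snd)
  have h1 := congrArg (fun ν => ∫⁻ q, G q.1 * f q.2 ∂ν) key
  rw [Measure.lintegral_compProd hm, lintegral_map hm (by fun_prop)] at h1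
  rw [lintegral_map (by exact hm.lintegral_kernel_prod_right') (by fun_prop)] at h1
  rw [← h1]
  refine lintegral_congr fun η => ?_
  change ∫⁻ z, G (Preorder.frestrictLe n η) * f z ∂(P (η n)) = _
  exact lintegral_const_mul _ hf

lemma measurableSet_avoidSet (x t : ℕ) : MeasurableSet (avoidSet x t) := by
  simp only [avoidSet, Set.ofPred_forall]
  refine .iInter fun s => .iInter fun _ => .iInter fun _ => ?_
  exact (measurableSet_eq_fun (measurable_pi_apply s) measurable_const).compl

lemma lintegral_avoidSet (P : Kernel ℕ ℕ) [IsMarkovKernel P] (x y t : ℕ) (g : ℕ → ℝ≥0∞) :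
    ∫⁻ η, (avoidSet x t).indicator 1 η * g (η t) ∂(chainLaw P y) = (killed P x)^[t] g y := by
  induction t generalizing g with
  | zero =>
    have : avoidSet x 0 = Set.univ := by
      ext η; simp only [avoidSet, Set.mem_ofPred_eq, Set.mem_univ, iff_true]; intro s; omega
    simp [this, lintegral_chainLaw_zero]
  | succ t ih =>
    -- The last step of the path is absorbed into the terminal function: the induction hypothesis is
    -- applied to `killed P x g` in place of `g`.
    rw [Function.iterate_succ_apply, ← ih]
    set S : Set ((i : Finset.Iic t) → ℕ) := {h | ∀ i : Finset.Iic t, 1 ≤ i.1 → h i ≠ x} with hS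
    have hSm : MeasurableSet S := by
      simp only [hS, Set.ofPred_forall]
      refine .iInter fun s => .iInter fun _ => ?_
      exact (measurableSet_eq_fun (measurable_pi_apply s) measurable_const).compl
    have hSt : ∀ η : ℕ → ℕ, Preorder.frestrictLe t η ∈ S ↔ η ∈ avoidSet x t := by
      intro η
      simp [hS, avoidSet]
      grind
    have h := lintegral_chainLaw_succ P y t (S.indicator 1) (measurable_one.indicator hSm)
      (fun z => if z = x then 0 else g z)
    have h2 : ∀ η : ℕ → ℕ, S.indicator (1 : (Finset.Iic t → ℕ) → ℝ≥0∞) (Preorder.frestrictLe t η)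
        = (avoidSet x t).indicator 1 η := by
      intro η
      by_cases hη : η ∈ avoidSet x t
      · rw [Set.indicator_of_mem hη, Set.indicator_of_mem ((hSt η).2 hη)]; rfl
      · rw [Set.indicator_of_notMem hη, Set.indicator_of_notMem (fun h => hη ((hSt η).1 h))]
    simp only [h2] at h
    change _ = ∫⁻ η, (avoidSet x t).indicator 1 η * ∫⁻ z, _ ∂(P (η t)) ∂(chainLaw P y)
    rw [← h]
    refine lintegral_congr fun η => ?_
    have h3 : η ∈ avoidSet x (t + 1) ↔ η ∈ avoidSet x t ∧ η (t + 1) ≠ x := by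
      simp only [avoidSet, Set.mem_ofPred_eq]
      constructor
      · intro h; exact ⟨fun s h1 h2 => h s h1 (by omega), h _ (by omega) le_rfl⟩
      · rintro ⟨h, h'⟩ s h1 h2
        rcases Nat.lt_or_ge t s with h4 | h4
        · obtain rfl : s = t + 1 := by omega
          exact h'
        · exact h s h1 h4
    by_cases ha : η ∈ avoidSet x t <;> by_cases hb : η (t + 1) = x <;>
      simp [Set.indicator, h3, ha, hb]

lemma chainLaw_avoidSet (P : Kernel ℕ ℕ) [IsMarkovKernel P] (x y t : ℕ) :
    chainLaw P y (avoidSet x t) = avoid P x t y := by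
  rw [avoid, ← lintegral_avoidSet, ← lintegral_indicator_one (measurableSet_avoidSet x t)]
  simp

lemma returnTime_lt_top_iff (x : ℕ) (η : ℕ → ℕ) :
    returnTime x η < ∞ ↔ ∃ t, 1 ≤ t ∧ η t = x := by
  simp [returnTime, iInf_lt_iff]

/-- The layer-cake formula: the return time counts the `t ≥ 0` that it strictly exceeds, and
`avoidSet x t` is the event that it exceeds `t`. -/
lemma returnTime_eq_tsum (x : ℕ) (η : ℕ → ℕ) :
    returnTime x η = ∑' t, (avoidSet x t).indicator 1 η := by
  classical
  by_cases h : ∃ t, 1 ≤ t ∧ η t = x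
  · have h1 : returnTime x η = (Nat.find h : ℝ≥0∞) := by
      refine le_antisymm (iInf₂_le (Nat.find h) (Nat.find_spec h)) (le_iInf₂ fun t ht => ?_)
      exact_mod_cast Nat.find_min' h ht
    have h2 : ∀ t, (avoidSet x t).indicator (1 : (ℕ → ℕ) → ℝ≥0∞) η
        = if t ∈ Finset.range (Nat.find h) then 1 else 0 := by
      intro t
      rw [Set.indicator_apply]
      congr 1
      simp only [avoidSet, Set.mem_ofPred_eq, Finset.mem_range, Nat.lt_find_iff, eq_iff_iff]
      grind
    rw [h1, tsum_congr h2, tsum_eq_sum (s := Finset.range (Nat.find h)) fun t ht => if_neg ht,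
      Finset.sum_congr rfl fun t ht => if_pos ht]
    simp
  · have h1 : returnTime x η = ∞ := by
      rw [← not_lt_top_iff, returnTime_lt_top_iff]; exact h
    have h2 : ∀ t, (avoidSet x t).indicator (1 : (ℕ → ℕ) → ℝ≥0∞) η = 1 := by
      intro t
      refine Set.indicator_of_mem ?_ _
      intro s hs _ hx
      exact h ⟨s, hs, hx⟩
    rw [h1, tsum_congr h2, ENNReal.tsum_const_eq_top_of_ne_zero one_ne_zero]

lemma meanReturnTime_eq_tsum (P : Kernel ℕ ℕ) [IsMarkovKernel P] (x : ℕ) :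
    meanReturnTime P x = ∑' t, avoid P x t x := by
  simp only [meanReturnTime, returnTime_eq_tsum]
  rw [lintegral_tsum fun t => (measurable_one.indicator (measurableSet_avoidSet x t)).aemeasurable]
  refine tsum_congr fun t => ?_
  rw [lintegral_indicator_one (measurableSet_avoidSet x t), chainLaw_avoidSet]

lemma avoidSet_antitone (x : ℕ) : Antitone (avoidSet x) :=
  fun _ _ hst _ hη s h1 h2 => hη s h1 (h2.trans hst)

lemma isRecurrentState_iff (P : Kernel ℕ ℕ) [IsMarkovKernel P] (x : ℕ) :
    IsRecurrentState P x ↔ Tendsto (fun t => avoid P x t x) atTop (𝓝 0) := by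
  have h1 : Tendsto (fun t => avoid P x t x) atTop (𝓝 (chainLaw P x (⋂ t, avoidSet x t))) := by
    simp only [← chainLaw_avoidSet]
    exact tendsto_measure_iInter_atTop (fun t => (measurableSet_avoidSet x t).nullMeasurableSet)
      (avoidSet_antitone x) ⟨0, measure_ne_top _ _⟩
  have h2 : IsRecurrentState P x ↔ chainLaw P x (⋂ t, avoidSet x t) = 0 := by
    rw [IsRecurrentState, ae_iff]
    have : {η : ℕ → ℕ | ¬ returnTime x η < ∞} = ⋂ t, avoidSet x t := by
      ext η
      simp only [returnTime_lt_top_iff, Set.mem_ofPred_eq, Set.mem_iInter, avoidSet]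
      push Not
      exact ⟨fun h t s h1 _ => h s h1, fun h s h1 => h s s h1 le_rfl⟩
    rw [this]
  rw [h2]
  exact ⟨fun h => h ▸ h1, fun h => tendsto_nhds_unique h1 h⟩

/-! ### Recurrence criteria for birth-and-death chains -/

/-- The mean of `g` after one step of the walk from `y`, where `P k` is the probability of the step
from `k + 1` to `k`. -/
def walkMean (P : ℕ → ℝ) (g : ℕ → ℝ) : ℕ → ℝ
  | 0 => g 0 / 2 + g 1 / 2
  | k + 1 => P k * g k + (1 - P k) * g (k + 2)

/-- The product of the ratios of the probabilities of the downward and the upward steps from the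
states `1, …, n`. -/
def ratioProd (P : ℕ → ℝ) (n : ℕ) : ℝ := ∏ k ∈ Finset.range n, P k / (1 - P k)

/-- The probability that the walk started at `y` does not visit `x` at times `1, …, t`, as a real
number. -/
def avoidReal (P : ℕ → ℝ) (x : ℕ) : ℕ → ℕ → ℝ
  | 0 => fun _ => 1
  | t + 1 => walkMean P (Function.update (avoidReal P x t) x 0)

/-- First-step analysis for the expected return time truncated at the horizon `T + 1`. -/
lemma sum_avoidReal_succ (P : ℕ → ℝ) (x T y : ℕ) :
    ∑ t ∈ Finset.range (T + 1), avoidReal P x t y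
      = 1 + walkMean P (Function.update (fun z => ∑ t ∈ Finset.range T, avoidReal P x t z) x 0) y := by
  have h : ∀ z, Function.update (fun z => ∑ t ∈ Finset.range T, avoidReal P x t z) x 0 z
      = ∑ t ∈ Finset.range T, Function.update (avoidReal P x t) x 0 z := by
    intro z
    simp only [Function.update_apply]
    split_ifs <;> simp
  rw [Finset.sum_range_succ', add_comm]
  congr 1
  cases y with
  | zero => simp only [walkMean, h, Finset.sum_div, ← Finset.sum_add_distrib]; rfl
  | succ k => simp only [walkMean, h, Finset.mul_sum, ← Finset.sum_add_distrib]; rfl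

section Real

variable {P : ℕ → ℝ} (hP : ∀ k, P k ∈ Set.Ioo (0 : ℝ) 1)

include hP

lemma walkMean_mono {f g : ℕ → ℝ} (h : ∀ z, f z ≤ g z) (y : ℕ) :
    walkMean P f y ≤ walkMean P g y := by
  cases y with
  | zero => simp only [walkMean]; linarith [h 0, h 1]
  | succ k =>
    have h1 := mul_le_mul_of_nonneg_left (h k) (hP k).1.le
    have h2 := mul_le_mul_of_nonneg_left (h (k + 2)) (sub_nonneg.2 (hP k).2.le)
    simp only [walkMean]; linarith

lemma ratioProd_pos (n : ℕ) : 0 < ratioProd P n :=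
  Finset.prod_pos fun k _ => div_pos (hP k).1 (sub_pos.2 (hP k).2)

lemma ratioProd_succ (n : ℕ) :
    (1 - P n) * ratioProd P (n + 1) = P n * ratioProd P n := by
  have := (sub_pos.2 (hP n).2).ne'
  rw [ratioProd, Finset.prod_range_succ, ← ratioProd]
  field_simp

lemma avoidReal_mem (x t y : ℕ) : avoidReal P x t y ∈ Set.Icc (0 : ℝ) 1 := by
  induction t generalizing y with
  | zero => simp [avoidReal]
  | succ t ih =>
    have h : ∀ z, Function.update (avoidReal P x t) x 0 z ∈ Set.Icc (0 : ℝ) 1 := by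
      intro z
      rw [Function.update_apply]
      split_ifs
      · simp
      · exact ih z
    have h0 := walkMean_mono hP (f := fun _ => 0) (fun z => (h z).1) y
    have h1 := walkMean_mono hP (g := fun _ => 1) (fun z => (h z).2) y
    constructor
    · refine le_trans (le_of_eq ?_) h0
      cases y <;> simp [walkMean]
    · refine h1.trans (le_of_eq ?_)
      cases y <;> simp [walkMean]; norm_num

lemma update_avoidReal_nonneg (x t y : ℕ) : 0 ≤ Function.update (avoidReal P x t) x 0 y := by
  rw [Function.update_apply]
  split_ifs
  · exact le_rfl
  · exact (avoidReal_mem hP x t y).1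

/-- A bounded function which vanishes at `x` and is harmonic off `x` vanishes, if the scale function
is unbounded. -/
lemma harmonic_eq_zero {x : ℕ} {g : ℕ → ℝ} (hx : g x = 0) (hg : ∀ y, g y ∈ Set.Icc (0 : ℝ) 1)
    (harm : ∀ y, y ≠ x → g y = walkMean P g y) (hA : ¬ Summable (ratioProd P)) (y : ℕ) :
    g y = 0 := by
  have hdiff : ∀ k, k + 1 ≠ x → (1 - P k) * (g (k + 2) - g (k + 1)) = P k * (g (k + 1) - g k) := by
    intro k hk
    have := harm (k + 1) hk
    simp only [walkMean] at this
    linear_combination -this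
  rcases le_total y x with hyx | hxy
  -- Below `x` the equation at `0`, where the walk stays put with probability `1 / 2`, makes the
  -- first increment vanish; all later ones are multiples of it.
  · have hz : ∀ k, k < x → g (k + 1) = g k := by
      intro k
      induction k with
      | zero =>
        intro h
        have := harm 0 h.ne
        simp only [walkMean] at this
        linarith
      | succ k ih =>
        intro h
        have h1 := hdiff k h.ne
        rw [ih (by omega), sub_self, mul_zero] at h1
        have h2 := (mul_eq_zero.1 h1).resolve_left (sub_pos.2 (hP k).2).ne'
        rw [ih (by omega)]
        linarith
    have hconst : ∀ k, k ≤ x → g k = g 0 := by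
      intro k
      induction k with
      | zero => simp
      | succ k ih => intro h; rw [hz k h, ih (by omega)]
    rw [hconst y hyx, ← hconst x le_rfl, hx]
  -- Above `x` the increments are proportional to `ratioProd`, so `g` is `g (x + 1)` times a
  -- rescaled partial sum of it. Boundedness of `g` then forces `g (x + 1) = 0`.
  · have hD : ∀ k, x ≤ k → ratioProd P x * (g (k + 1) - g k) = ratioProd P k * g (x + 1) := by
      intro k hk
      induction k, hk using Nat.le_induction with
      | base => rw [hx, sub_zero]
      | succ k hk ih =>
        have h1 := hdiff k (by omega)
        have h2 := ratioProd_succ hP k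
        have h3 := (sub_pos.2 (hP k).2).ne'
        refine mul_left_cancel₀ h3 ?_
        linear_combination ratioProd P x * h1 + P k * ih - g (x + 1) * h2
    have hsum : ∀ n, ratioProd P x * g (n + x)
        = (∑ k ∈ Finset.range n, ratioProd P (k + x)) * g (x + 1) := by
      intro n
      induction n with
      | zero => simp [hx]
      | succ n ih =>
        rw [Finset.sum_range_succ, add_mul, ← ih, ← hD (n + x) (by omega),
          show n + 1 + x = n + x + 1 by omega]
        ring
    have h1 : g (x + 1) = 0 := by
      by_contra hne
      have hpos : 0 < g (x + 1) := lt_of_le_of_ne (hg _).1 (Ne.symm hne)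
      refine hA ((summable_nat_add_iff x).1 (summable_of_sum_range_le
        (c := ratioProd P x / g (x + 1)) (fun n => (ratioProd_pos hP _).le) fun n => ?_))
      rw [le_div_iff₀ hpos, ← hsum]
      exact mul_le_of_le_one_right (ratioProd_pos hP x).le (hg _).2
    have h2 := hsum (y - x)
    rw [h1, mul_zero, Nat.sub_add_cancel hxy] at h2
    exact (mul_eq_zero.1 h2).resolve_left (ratioProd_pos hP x).ne'

lemma avoidReal_antitone (x y : ℕ) : Antitone fun t => avoidReal P x t y := by
  refine antitone_nat_of_succ_le fun t => ?_
  induction t generalizing y with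
  | zero => exact (avoidReal_mem hP x 1 y).2
  | succ t ih =>
    refine walkMean_mono hP (fun z => ?_) y
    simp only [Function.update_apply]
    split_ifs
    · exact le_rfl
    · exact ih z

/-- The avoidance probabilities decrease to a fixed point of the killed operator. Reset to `0` at
`x`, this limit satisfies the hypotheses of `harmonic_eq_zero`. -/
lemma tendsto_avoidReal (x : ℕ) (hA : ¬ Summable (ratioProd P)) :
    Tendsto (fun t => avoidReal P x t x) atTop (𝓝 0) := by
  have hlim : ∀ y, ∃ l, Tendsto (fun t => avoidReal P x t y) atTop (𝓝 l) := fun y =>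
    ⟨_, tendsto_atTop_ciInf (avoidReal_antitone hP x y)
      ⟨0, by rintro _ ⟨t, rfl⟩; exact (avoidReal_mem hP x t y).1⟩⟩
  choose h hh using hlim
  have hupd : ∀ z, Tendsto (fun t => Function.update (avoidReal P x t) x 0 z) atTop
      (𝓝 (Function.update h x 0 z)) := by
    intro z
    simp only [Function.update_apply]
    split_ifs
    · exact tendsto_const_nhds
    · exact hh z
  have hstep : ∀ y, h y = walkMean P (Function.update h x 0) y := by
    intro y
    refine tendsto_nhds_unique ((tendsto_add_atTop_iff_nat 1).2 (hh y)) ?_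
    change Tendsto (fun t => walkMean P (Function.update (avoidReal P x t) x 0) y) _ _
    cases y with
    | zero => exact ((hupd 0).div_const 2).add ((hupd 1).div_const 2)
    | succ k => exact ((hupd k).const_mul _).add ((hupd (k + 2)).const_mul _)
  have hzero := harmonic_eq_zero hP (x := x) (g := Function.update h x 0) (by simp)
    (fun z => ⟨ge_of_tendsto' (hupd z) fun t => update_avoidReal_nonneg hP x t z, ?_⟩)
    (fun z hz => by rw [← hstep z, Function.update_of_ne hz]) hA
  · have : h x = 0 := by
      rw [hstep x]
      cases x <;> simp only [walkMean, hzero] <;> simp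
    simpa [this] using hh x
  · refine le_of_tendsto' (hupd z) fun t => ?_
    rw [Function.update_apply]
    split_ifs
    · exact zero_le_one
    · exact (avoidReal_mem hP x t z).2

/-- If the scale function is bounded, the probability of no return is positive. -/
lemma exists_le_avoidReal (x : ℕ) (hA : Summable (ratioProd P)) :
    ∃ δ > 0, ∀ t, δ ≤ avoidReal P x t x := by
  set B := ∑' n, ratioProd P n with hB
  have hBpos : 0 < B := hA.tsum_pos (fun n => (ratioProd_pos hP n).le) 0 (ratioProd_pos hP 0)
  -- The scale function started at `x` and divided by its total mass: it is subharmonic, vanishes at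
  -- `x` and is at most `1`, so it bounds every avoidance probability from below.
  set g : ℕ → ℝ := fun y => (∑ m ∈ Finset.Ico x y, ratioProd P m) / B with hg
  have hg0 : ∀ y, 0 ≤ g y := fun y =>
    div_nonneg (Finset.sum_nonneg fun m _ => (ratioProd_pos hP m).le) hBpos.le
  have hgx : ∀ y, y ≤ x → g y = 0 := by
    intro y hy
    simp [hg, Finset.Ico_eq_empty_of_le hy]
  have hg1 : ∀ y, g y ≤ 1 := by
    intro y
    rw [hg, div_le_one hBpos]
    exact hA.sum_le_tsum _ fun m _ => (ratioProd_pos hP m).le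
  have hsub : ∀ y, g y ≤ walkMean P g y := by
    intro y
    rcases le_or_gt y x with hy | hy
    · rw [hgx y hy]
      cases y with
      | zero => simp only [walkMean]; linarith [hg0 0, hg0 1]
      | succ k =>
        have h1 := mul_nonneg (hP k).1.le (hg0 k)
        have h2 := mul_nonneg (sub_nonneg.2 (hP k).2.le) (hg0 (k + 2))
        simp only [walkMean]; linarith
    · obtain ⟨k, rfl⟩ : ∃ k, y = k + 1 := ⟨y - 1, by omega⟩
      have h1 : ∀ m, x ≤ m → g (m + 1) = g m + ratioProd P m / B := by
        intro m hm
        simp only [hg]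
        rw [Finset.sum_Ico_succ_top hm, add_div]
      have h2 := ratioProd_succ hP k
      simp only [walkMean]
      rw [h1 (k + 1) (by omega), h1 k (by omega)]
      refine le_of_eq ?_
      field_simp
      linear_combination -h2
  have hle : ∀ t y, g y ≤ avoidReal P x t y := by
    intro t
    induction t with
    | zero => exact hg1
    | succ t ih =>
      intro y
      refine (hsub y).trans (walkMean_mono hP (fun z => ?_) y)
      rw [Function.update_apply]
      split_ifs with hz
      · rw [hz, hgx x le_rfl]
      · exact ih z
  have hg' : 0 < g (x + 1) := by
    simpa [hg] using div_pos (ratioProd_pos hP x) hBpos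
  refine ⟨walkMean P g x, ?_, fun t => ?_⟩
  · cases x with
    | zero => simp only [walkMean]; linarith [hg0 0]
    | succ k =>
      have h1 := mul_nonneg (hP k).1.le (hg0 k)
      have h2 := mul_pos (sub_pos.2 (hP k).2) hg'
      simp only [walkMean]; linarith
  · refine le_trans ?_ (avoidReal_antitone hP x x (Nat.le_succ t))
    refine walkMean_mono hP (fun z => ?_) x
    rw [Function.update_apply]
    split_ifs with hz
    · rw [hz, hgx x le_rfl]
    · exact hle t z

/-- A Lyapunov function for the expected hitting time of `x`. -/
lemma exists_lyapunov (x : ℕ) (hA : Summable fun n => (ratioProd P n)⁻¹) :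
    ∃ V : ℕ → ℝ, V x = 0 ∧ (∀ y, 0 ≤ V y) ∧ ∀ y, y ≠ x → 1 + walkMean P V y ≤ V y := by
  -- Up to a constant, the left side is the reversible weight of the state `j + 1`; the right side
  -- adds the conductances of its two edges.
  have hw : ∀ j, (ratioProd P j * P j)⁻¹ = (ratioProd P j)⁻¹ + (ratioProd P (j + 1))⁻¹ := by
    intro j
    have h1 := (ratioProd_pos hP j).ne'
    have h2 := (ratioProd_pos hP (j + 1)).ne'
    have h3 := ratioProd_succ hP j
    have h4 := (hP j).1.ne'
    generalize ratioProd P (j + 1) = b at *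
    generalize ratioProd P j = a at *
    field_simp
    linear_combination h3
  have hs : Summable fun j => (ratioProd P j * P j)⁻¹ := by
    simp only [hw]
    exact hA.add ((summable_nat_add_iff (f := fun n => (ratioProd P n)⁻¹) 1).2 hA)
  set T : ℕ → ℝ := fun k => ∑' j, (ratioProd P (j + k) * P (j + k))⁻¹ with hT
  have hTs : ∀ k, T k = (ratioProd P k * P k)⁻¹ + T (k + 1) := by
    intro k
    have := ((summable_nat_add_iff (f := fun j => (ratioProd P j * P j)⁻¹) k).2 hs).tsum_eq_zero_add
    simp only [zero_add] at this
    simp only [hT]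
    rw [this]
    congr 1
    refine tsum_congr fun j => ?_
    rw [show j + 1 + k = j + (k + 1) by omega]
  have hT0 : ∀ k, 0 ≤ T k := fun k => tsum_nonneg fun j =>
    inv_nonneg.2 (mul_nonneg (ratioProd_pos hP _).le (hP _).1.le)
  -- The expected passage time from `k` to `k + 1`. It starts at `2` because the waiting time at `0`
  -- is geometric with parameter `1 / 2`.
  set e : ℕ → ℝ := fun k => Nat.rec 2 (fun j ej => (1 + P j * ej) / (1 - P j)) k with he
  have he1 : ∀ j, (1 - P j) * e (j + 1) = 1 + P j * e j := fun j =>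
    mul_div_cancel₀ _ (sub_pos.2 (hP j).2).ne'
  have he0 : ∀ j, 0 ≤ e j := by
    intro j
    induction j with
    | zero => simp [he]
    | succ j ih =>
      have := mul_nonneg (hP j).1.le ih
      exact div_nonneg (by linarith) (sub_pos.2 (hP j).2).le
  -- The expected hitting time of `x`: upward passage times below `x`; above `x` the passage time
  -- from `k + 1` down to `k` is `ratioProd P k` times the tail `T k` of the reversible measure.
  set V : ℕ → ℝ := fun y =>
    ∑ j ∈ Finset.Ico y x, e j + ∑ k ∈ Finset.Ico x y, ratioProd P k * T k with hV
  have hVlow : ∀ k, k < x → V k = V (k + 1) + e k := by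
    intro k hk
    simp only [hV]
    rw [Finset.sum_eq_sum_Ico_succ_bot hk, Finset.Ico_eq_empty_of_le hk.le,
      Finset.Ico_eq_empty_of_le (show k + 1 ≤ x from hk)]
    simp [add_comm]
  have hVup : ∀ k, x ≤ k → V (k + 1) = V k + ratioProd P k * T k := by
    intro k hk
    simp only [hV]
    rw [Finset.sum_Ico_succ_top hk, Finset.Ico_eq_empty_of_le hk,
      Finset.Ico_eq_empty_of_le (show x ≤ k + 1 by omega)]
    simp
  refine ⟨V, by simp [hV], fun y => add_nonneg (Finset.sum_nonneg fun j _ => he0 j)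
    (Finset.sum_nonneg fun k _ => mul_nonneg (ratioProd_pos hP k).le (hT0 k)), fun y hy => ?_⟩
  refine le_of_eq ?_
  rcases Nat.lt_or_gt_of_ne hy with h | h
  · cases y with
    | zero =>
      have h1 := hVlow 0 h
      have h2 : e 0 = 2 := rfl
      simp only [walkMean]
      simp only [zero_add] at h1
      linarith
    | succ k =>
      have h1 := hVlow k (by omega)
      have h2 := hVlow (k + 1) h
      have h3 := he1 k
      simp only [walkMean]
      linear_combination P k * h1 - (1 - P k) * h2 - h3
  · obtain ⟨k, rfl⟩ : ∃ k, y = k + 1 := ⟨y - 1, by omega⟩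
    have h1 := hVup k (by omega)
    have h2 := hVup (k + 1) (by omega)
    have h3 := hTs k
    have h4 := ratioProd_succ hP k
    have h5 : ratioProd P k * P k * (ratioProd P k * P k)⁻¹ = 1 :=
      mul_inv_cancel₀ (mul_pos (ratioProd_pos hP k) (hP k).1).ne'
    simp only [walkMean]
    linear_combination (1 - P k) * h2 - P k * h1 + T (k + 1) * h4 - ratioProd P k * P k * h3 - h5

/-- By induction on the horizon, the Lyapunov function dominates the truncated expected hitting
times off `x`; one more step from `x` bounds the return time. -/
lemma exists_sum_avoidReal_le (x : ℕ) (hA : Summable fun n => (ratioProd P n)⁻¹) :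
    ∃ C, ∀ T, ∑ t ∈ Finset.range T, avoidReal P x t x ≤ C := by
  obtain ⟨V, hVx, hV0, hV⟩ := exists_lyapunov hP x hA
  have h : ∀ T y, Function.update (fun z => ∑ t ∈ Finset.range T, avoidReal P x t z) x 0 y ≤ V y := by
    intro T
    induction T with
    | zero =>
      intro y
      simp only [Function.update_apply]
      split_ifs
      · exact hV0 y
      · simpa using hV0 y
    | succ T ih =>
      intro y
      rw [Function.update_apply]
      split_ifs with hy
      · exact hV0 y
      · rw [sum_avoidReal_succ P]
        exact (add_le_add le_rfl (walkMean_mono hP ih y)).trans (hV y hy)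
  refine ⟨1 + walkMean P V x, fun T => ?_⟩
  refine le_trans ?_ (add_le_add le_rfl (walkMean_mono hP (h T) x))
  rw [← sum_avoidReal_succ P]
  exact Finset.sum_le_sum_of_subset_of_nonneg (Finset.range_mono (Nat.le_succ T))
    fun t _ _ => (avoidReal_mem hP x t x).1

/-- If finite expected hitting times exist, the reversible measure is summable. -/
lemma summable_inv_ratioProd_of_drift {x : ℕ} {v : ℕ → ℝ} (hv0 : ∀ k, 0 ≤ v k)
    (hv : ∀ k, x ≤ k → v (k + 1) = 1 + P k * v k + (1 - P k) * v (k + 2)) :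
    Summable fun n => (ratioProd P n)⁻¹ := by
  set D : ℕ → ℝ := fun k => v (k + 1) - v k with hD
  have hDs : ∀ k, x ≤ k → P k * D k = 1 + (1 - P k) * D (k + 1) := by
    intro k hk
    have := hv k hk
    simp only [hD]
    linear_combination this
  have hneg : ∀ k, x ≤ k → D k ≤ 0 → D (k + 1) ≤ -1 := by
    intro k hk h
    have h1 := hDs k hk
    have h2 := (hP k).1
    have h3 := (hP k).2
    have h4 : P k * D k ≤ 0 := mul_nonpos_of_nonneg_of_nonpos h2.le h
    by_contra! h5
    have h6 := mul_lt_mul_of_pos_left h5 (sub_pos.2 h3)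
    linarith
  -- A negative increment would make all later ones at most `-1`, driving `v` below `0`.
  have hD0 : ∀ k, x ≤ k → 0 ≤ D k := by
    intro k hk
    by_contra! h
    have hall : ∀ n, D (k + 1 + n) ≤ -1 := by
      intro n
      induction n with
      | zero => exact hneg k hk h.le
      | succ n ih => exact hneg (k + 1 + n) (by omega) (by linarith)
    have hdec : ∀ n : ℕ, v (k + 1 + n) ≤ v (k + 1) - n := by
      intro n
      induction n with
      | zero => simp
      | succ n ih =>
        have := hall n
        simp only [hD] at this
        rw [← add_assoc]
        push_cast
        linarith
    obtain ⟨n, hn⟩ := exists_nat_gt (v (k + 1))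
    linarith [hdec n, hv0 (k + 1 + n)]
  -- Summed over `k`, this telescopes and bounds the partial sums of the inverse products.
  have hstep : ∀ k, x ≤ k → (ratioProd P k)⁻¹ + D (k + 1) * (ratioProd P (k + 1))⁻¹
      ≤ D k * (ratioProd P k)⁻¹ := by
    intro k hk
    have h1 := hDs k hk
    have h2 := ratioProd_succ hP k
    have h3 := ratioProd_pos hP k
    have h4 := ratioProd_pos hP (k + 1)
    have h5 := (hP k).1
    have h6 : D k * (ratioProd P k)⁻¹ =
        (P k)⁻¹ * (ratioProd P k)⁻¹ + D (k + 1) * (ratioProd P (k + 1))⁻¹ := by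
      field_simp
      linear_combination ratioProd P (k + 1) * h1 + D (k + 1) * h2
    rw [h6]
    have h7 : 1 ≤ (P k)⁻¹ := (one_le_inv₀ h5).2 (hP k).2.le
    have := le_mul_of_one_le_left (inv_pos.2 h3).le h7
    linarith
  refine (summable_nat_add_iff x).1 (summable_of_sum_range_le
    (c := D x * (ratioProd P x)⁻¹) (fun n => (inv_pos.2 (ratioProd_pos hP _)).le) fun n => ?_)
  have : ∑ k ∈ Finset.range n, (ratioProd P (k + x))⁻¹
      + D (n + x) * (ratioProd P (n + x))⁻¹ ≤ D x * (ratioProd P x)⁻¹ := by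
    induction n with
    | zero => simp
    | succ n ih =>
      have := hstep (n + x) (by omega)
      rw [Finset.sum_range_succ, show n + 1 + x = n + x + 1 by omega]
      linarith
  have h8 := mul_nonneg (hD0 (n + x) (by omega)) (inv_pos.2 (ratioProd_pos hP (n + x))).le
  linarith

/-- A finite mean return time to `x` makes the expected hitting times of `x` from all states above
finite, and these solve the equation of `summable_inv_ratioProd_of_drift`. -/
lemma summable_inv_ratioProd_of_summable_avoidReal (x : ℕ)
    (hs : Summable fun t => avoidReal P x t x) : Summable fun n => (ratioProd P n)⁻¹ := by
  have hw : ∀ y, x ≤ y → Summable fun t => Function.update (avoidReal P x t) x 0 y := by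
    have hup : ∀ y, x ≤ y → Summable fun t => avoidReal P x t y := by
      intro y hy
      induction y, hy using Nat.le_induction with
      | base => exact hs
      | succ y hy ih =>
        -- Here `q` is the probability of the upward step from `y`: stepping up and then avoiding
        -- `x` is one way to avoid `x`.
        obtain ⟨q, hq, hqle⟩ : ∃ q > 0, ∀ t, q * avoidReal P x t (y + 1) ≤ avoidReal P x (t + 1) y := by
          have hne : y + 1 ≠ x := by omega
          cases y with
          | zero =>
            refine ⟨1 / 2, by norm_num, fun t => ?_⟩
            have h0 := update_avoidReal_nonneg hP x t 0
            simp only [avoidReal, walkMean]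
            rw [zero_add] at hne
            rw [Function.update_of_ne hne, zero_add]
            linarith
          | succ k =>
            refine ⟨1 - P k, sub_pos.2 (hP k).2, fun t => ?_⟩
            have h0 := mul_nonneg (hP k).1.le (update_avoidReal_nonneg hP x t k)
            simp only [avoidReal, walkMean]
            rw [Function.update_of_ne hne]
            linarith
        have h1 := ((summable_nat_add_iff 1).2 ih).of_nonneg_of_le
          (fun t => mul_nonneg hq.le (avoidReal_mem hP x t (y + 1)).1) hqle
        exact (summable_mul_left_iff hq.ne').1 h1
    intro y hy
    simp only [Function.update_apply]
    split_ifs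
    · exact summable_zero
    · exact hup y hy
  refine summable_inv_ratioProd_of_drift hP (x := x)
    (v := fun y => ∑' t, Function.update (avoidReal P x t) x 0 y)
    (fun k => tsum_nonneg fun t => update_avoidReal_nonneg hP x t k) fun k hk => ?_
  rw [(hw (k + 1) (by omega)).tsum_eq_zero_add, add_assoc, ← tsum_mul_left, ← tsum_mul_left,
    ← ((hw k hk).mul_left _).tsum_add ((hw (k + 2) (by omega)).mul_left _)]
  have hne : k + 1 ≠ x := by omega
  simp only [Function.update_of_ne hne]
  rfl

end Real

/-! ### Transfer of the criteria to the kernel of the walk -/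

section Walk

variable (p : ℕ+ → unitInterval)

/-- The probability of the step from `k + 1` to `k` in the environment `p`. -/
def downProb (k : ℕ) : ℝ := p k.succPNat

lemma killed_walkKernel (x : ℕ) {f : ℕ → ℝ≥0∞} {g : ℕ → ℝ} (hg : ∀ z, 0 ≤ g z)
    (h : ∀ z, f z = ENNReal.ofReal (g z)) (y : ℕ) :
    killed (walkKernel p) x f y
      = ENNReal.ofReal (walkMean (downProb p) (Function.update g x 0) y) := by
  have h' : ∀ z, (if z = x then 0 else f z) = ENNReal.ofReal (Function.update g x 0 z) := by
    intro z
    rw [Function.update_apply]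
    split_ifs <;> simp [h]
  have hg' : ∀ z, 0 ≤ Function.update g x 0 z := by
    intro z
    rw [Function.update_apply]
    split_ifs <;> simp [hg]
  unfold killed
  simp only [h']
  change ∫⁻ z, _ ∂(step p y) = _
  cases y with
  | zero =>
    simp only [step, lintegral_add_measure, lintegral_smul_measure, lintegral_dirac, walkMean]
    rw [ENNReal.ofReal_add (by linarith [hg' 0]) (by linarith [hg' 1]),
      ENNReal.ofReal_div_of_pos two_pos, ENNReal.ofReal_div_of_pos two_pos]
    simp [ENNReal.div_eq_inv_mul]
  | succ k =>
    have h1 : 0 ≤ downProb p k := (p k.succPNat).2.1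
    have h2 : 0 ≤ 1 - downProb p k := sub_nonneg.2 (p k.succPNat).2.2
    simp only [step, lintegral_add_measure, lintegral_smul_measure, lintegral_dirac, walkMean]
    rw [ENNReal.ofReal_add (mul_nonneg h1 (hg' _)) (mul_nonneg h2 (hg' _)),
      ENNReal.ofReal_mul h1, ENNReal.ofReal_mul h2]
    rfl

variable {p}

lemma avoid_walkKernel (hP : ∀ k, downProb p k ∈ Set.Ioo (0 : ℝ) 1) (x t y : ℕ) :
    avoid (walkKernel p) x t y = ENNReal.ofReal (avoidReal (downProb p) x t y) := by
  induction t generalizing y with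
  | zero => simp [avoid_zero, avoidReal]
  | succ t ih =>
    rw [avoid_succ, killed_walkKernel p x (fun z => (avoidReal_mem hP x t z).1) ih]
    rfl

theorem isTransient_walkKernel (hP : ∀ k, downProb p k ∈ Set.Ioo (0 : ℝ) 1)
    (hA : Summable (ratioProd (downProb p))) : IsTransient (walkKernel p) := by
  intro x hx
  rw [isRecurrentState_iff] at hx
  obtain ⟨δ, hδ, h⟩ := exists_le_avoidReal hP x hA
  have h1 := ge_of_tendsto' (b := ENNReal.ofReal δ) hx fun t => by
    rw [avoid_walkKernel hP]
    exact ENNReal.ofReal_le_ofReal (h t)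
  exact absurd (ENNReal.ofReal_pos.2 hδ) (not_lt.2 h1)

theorem isErgodic_walkKernel (hP : ∀ k, downProb p k ∈ Set.Ioo (0 : ℝ) 1)
    (hA : Summable fun n => (ratioProd (downProb p) n)⁻¹) : IsErgodic (walkKernel p) := by
  intro x
  obtain ⟨C, hC⟩ := exists_sum_avoidReal_le hP x hA
  have hs : Summable fun t => avoidReal (downProb p) x t x :=
    summable_of_sum_range_le (fun t => (avoidReal_mem hP x t x).1) hC
  constructor
  · rw [isRecurrentState_iff]
    simp only [avoid_walkKernel hP]
    simpa using ENNReal.tendsto_ofReal hs.tendsto_atTop_zero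
  · rw [meanReturnTime_eq_tsum]
    simp only [avoid_walkKernel hP]
    rw [← ENNReal.ofReal_tsum_of_nonneg (fun t => (avoidReal_mem hP x t x).1) hs]
    exact ENNReal.ofReal_lt_top

theorem isNullRecurrent_walkKernel (hP : ∀ k, downProb p k ∈ Set.Ioo (0 : ℝ) 1)
    (hA : ¬ Summable (ratioProd (downProb p)))
    (hA' : ¬ Summable fun n => (ratioProd (downProb p) n)⁻¹) : IsNullRecurrent (walkKernel p) := by
  intro x
  constructor
  · rw [isRecurrentState_iff]
    simp only [avoid_walkKernel hP]
    simpa using ENNReal.tendsto_ofReal (tendsto_avoidReal hP x hA)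
  · rw [meanReturnTime_eq_tsum]
    by_contra h
    refine hA' (summable_inv_ratioProd_of_summable_avoidReal hP x ?_)
    refine (ENNReal.summable_toReal h).congr fun t => ?_
    rw [avoid_walkKernel hP, ENNReal.toReal_ofReal (avoidReal_mem hP x t x).1]

end Walk

/-! ### Summability of the products in deterministic environments -/

lemma ratioProd_add (P : ℕ → ℝ) (N n : ℕ) :
    ratioProd P (n + N) = ratioProd P N * ratioProd (fun k => P (k + N)) n := by
  simp only [ratioProd]
  rw [add_comm n N, Finset.prod_range_add]
  simp only [add_comm N]

lemma ratioProd_one_sub (P : ℕ → ℝ) (n : ℕ) :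
    ratioProd (fun k => 1 - P k) n = (ratioProd P n)⁻¹ := by
  simp [ratioProd]

lemma summable_ratioProd_shift_iff {P : ℕ → ℝ} (hP : ∀ k, P k ∈ Set.Ioo (0 : ℝ) 1) (N : ℕ) :
    Summable (ratioProd fun k => P (k + N)) ↔ Summable (ratioProd P) := by
  rw [← summable_nat_add_iff (f := ratioProd P) N]
  simp only [ratioProd_add]
  exact (summable_mul_left_iff (ratioProd_pos hP N).ne').symm

lemma summable_ratioProd_of_tendsto {P : ℕ → ℝ} (hP : ∀ k, P k ∈ Set.Ioo (0 : ℝ) 1) {l : ℝ}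
    (hl : l < 1 / 2) (h : Tendsto P atTop (𝓝 l)) : Summable (ratioProd P) := by
  have hl1 : 0 < 1 - l := by linarith
  refine summable_of_ratio_test_tendsto_lt_one (l := l / (1 - l))
    ((div_lt_one hl1).2 (by linarith)) (.of_forall fun n => (ratioProd_pos hP n).ne') ?_
  refine (h.div (h.const_sub 1) hl1.ne').congr fun n => ?_
  have h1 := ratioProd_pos hP n
  have h2 := ratioProd_pos hP (n + 1)
  rw [Real.norm_of_nonneg h1.le, Real.norm_of_nonneg h2.le, Pi.div_apply,
    div_eq_div_iff (sub_pos.2 (hP n).2).ne' h1.ne', ← ratioProd_succ hP n]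
  ring

/-- Each ratio is at least `exp (-2 |x k| / δ)`, so the products stay above a positive constant and
cannot tend to `0`. -/
lemma not_summable_ratioProd {P x : ℕ → ℝ} {δ : ℝ} (hδ : 0 < δ)
    (hP : ∀ k, P k ∈ Set.Icc δ (1 - δ)) (hx : Summable x) (h : ∀ k, 1 / 2 - x k ≤ P k) :
    ¬ Summable (ratioProd P) := by
  have hx0 : Summable fun k => 2 * |x k| / δ := (hx.abs.mul_left 2).div_const δ
  have hr : ∀ k, Real.exp (-(2 * |x k| / δ)) ≤ P k / (1 - P k) := by
    intro k
    have h1 := (hP k).1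
    have h2 : 0 < 1 - P k := by linarith [(hP k).2]
    have h3 : 0 < P k := hδ.trans_le h1
    rw [Real.exp_neg, ← inv_div (1 - P k)]
    refine inv_anti₀ (div_pos h2 h3) (le_trans ?_ (Real.add_one_le_exp _))
    rw [div_le_iff₀ h3]
    have h4 : 2 * |x k| ≤ 2 * |x k| / δ * P k := by
      rw [div_mul_eq_mul_div, le_div_iff₀ hδ]
      exact mul_le_mul_of_nonneg_left h1 (by positivity)
    linarith [h k, le_abs_self (x k)]
  intro hs
  have hlow : ∀ n, Real.exp (-∑' k, 2 * |x k| / δ) ≤ ratioProd P n := by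
    intro n
    refine le_trans ?_ (Finset.prod_le_prod (fun k _ => (Real.exp_pos _).le) fun k _ => hr k)
    rw [← Real.exp_sum, Finset.sum_neg_distrib]
    exact Real.exp_le_exp.2 (neg_le_neg (hx0.sum_le_tsum _ fun k _ => by positivity))
  exact absurd (Real.exp_pos _) (not_lt.2 (ge_of_tendsto' hs.tendsto_atTop_zero hlow))

/-! ### The truncation -/

section Truncate

variable {ε : ℝ} (hε : ε ∈ Set.Ioo (0 : ℝ) (1 / 2))

include hε

lemma truncate_eq_max_min (x : ℝ) : truncate ε x = max (ε / 2) (min x (1 - ε / 2)) := by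
  have h0 := hε.1
  have h1 := hε.2
  unfold truncate
  split_ifs with h h'
  · rw [min_eq_left (by linarith), max_eq_left h.le]
  · rw [min_eq_right h'.le, max_eq_right (by linarith)]
  · rw [min_eq_left (not_lt.1 h'), max_eq_right (not_lt.1 h)]

lemma continuous_truncate : Continuous (truncate ε) := by
  simp only [funext (truncate_eq_max_min hε)]
  fun_prop

lemma truncate_mem_Ioo (x : ℝ) : truncate ε x ∈ Set.Ioo (0 : ℝ) 1 := by
  have h := truncate_mem hε x
  exact ⟨by linarith [h.1, hε.1], by linarith [h.2, hε.1]⟩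

lemma truncate_half_sub (x : ℝ) : truncate ε (1 / 2 - x) = 1 - truncate ε (1 / 2 + x) := by
  have h0 := hε.1
  have h1 := hε.2
  unfold truncate
  split_ifs <;> linarith

lemma half_sub_abs_le_truncate (x : ℝ) : 1 / 2 - |x| ≤ truncate ε (1 / 2 + x) := by
  have h0 := hε.1
  have h1 := hε.2
  have h2 := neg_abs_le x
  have h3 := abs_nonneg x
  unfold truncate
  split_ifs <;> linarith

omit hε in
lemma truncate_of_mem {x : ℝ} (hx : x ∈ Set.Icc (ε / 2) (1 - ε / 2)) : truncate ε x = x := by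
  unfold truncate
  rw [if_neg (not_lt.2 hx.1), if_neg (not_lt.2 hx.2)]

lemma tendsto_truncate {c : ℝ} (hc : c ∈ Set.Icc ε (1 - ε)) {x z : ℕ → ℝ}
    (hz : ∀ k, z k ∈ Set.Icc (-1 : ℝ) 1) (hx : Tendsto x atTop (𝓝 0)) :
    Tendsto (fun k => truncate ε (c + z k * x k)) atTop (𝓝 c) := by
  have h1 : Tendsto (fun k => z k * x k) atTop (𝓝 0) := by
    refine squeeze_zero_norm (a := fun k => |x k|) (fun k => ?_) (by simpa using hx.abs)
    rw [norm_mul, Real.norm_eq_abs, Real.norm_eq_abs]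
    exact mul_le_of_le_one_left (abs_nonneg _) (abs_le.2 (hz k))
  have h2 := ((continuous_truncate hε).tendsto (c + 0)).comp (h1.const_add c)
  rwa [add_zero, truncate_of_mem ⟨by linarith [hc.1, hε.1], by linarith [hc.2, hε.1]⟩] at h2

end Truncate

/-! ### Random environments -/

section Random

variable {Ω : Type*} [MeasurableSpace Ω] {μ : Measure Ω} [IsProbabilityMeasure μ]
  {ε : ℝ} (hε : ε ∈ Set.Ioo (0 : ℝ) (1 / 2))

include hε

omit [IsProbabilityMeasure μ] hε in
lemma summable_iff_tsum_ofReal_ne_top {f : ℕ → ℝ} (hf : ∀ n, 0 ≤ f n) :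
    Summable f ↔ ∑' n, ENNReal.ofReal (f n) ≠ ∞ := by
  refine ⟨fun h => h.tsum_ofReal_ne_top, fun h => (ENNReal.summable_toReal h).congr fun n => ?_⟩
  exact ENNReal.toReal_ofReal (hf n)

/-- The ratio of the transition probabilities has mean at most `((k + 1) / (k + 2)) ^ 2` if the
drift is at least `1 / (k + 1)`. -/
lemma lintegral_ratio_le {Z : Ω → ℝ} (hZ : Measurable Z) (hZ1 : ∀ ω, Z ω ∈ Set.Icc (-1 : ℝ) 1)
    {m x : ℝ} (hm : m = ∫ ω, Z ω ∂μ) (hx0 : 0 ≤ x) (hx4 : x ≤ 1 / 4) (hx8 : 8 * x ≤ m) {k : ℕ}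
    (hk : 1 ≤ m * x * (k + 1)) :
    ∫⁻ ω, ENNReal.ofReal (truncate ε (1 / 2 - Z ω * x) / (1 - truncate ε (1 / 2 - Z ω * x))) ∂μ
      ≤ ENNReal.ofReal (((k + 1 : ℝ) / (k + 2)) ^ 2) := by
  have hZi : Integrable Z μ := Integrable.of_bound hZ.aestronglyMeasurable 1
    (.of_forall fun ω => abs_le.2 (hZ1 ω))
  -- With `u = Z ω * x` the ratio is `1 - 4 * u + 8 * u ^ 2 / (1 + 2 * u)`, and `|u| ≤ 1 / 4` makes
  -- the last denominator at least `1 / 2`. The truncation is inactive in this range.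
  have hpt : ∀ ω, truncate ε (1 / 2 - Z ω * x) / (1 - truncate ε (1 / 2 - Z ω * x))
      ≤ 1 + 16 * x ^ 2 - 4 * x * Z ω := by
    intro ω
    obtain ⟨h1, h2⟩ := hZ1 ω
    have h0 := hε.1
    have h0' := hε.2
    have h3 : Z ω * x ≤ 1 / 4 := by nlinarith
    have h4 : -(1 / 4) ≤ Z ω * x := by nlinarith
    rw [truncate_of_mem ⟨by linarith, by linarith⟩, div_le_iff₀ (by linarith)]
    have h5 : (Z ω * x) ^ 2 ≤ x ^ 2 := by
      rw [mul_pow]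
      exact mul_le_of_le_one_left (sq_nonneg x) (by nlinarith)
    nlinarith
  have hi : Integrable (fun ω => 1 + 16 * x ^ 2 - 4 * x * Z ω) μ :=
    (integrable_const _).sub (hZi.const_mul _)
  have hpos : ∀ ω, 0 ≤ truncate ε (1 / 2 - Z ω * x) / (1 - truncate ε (1 / 2 - Z ω * x)) :=
    fun ω => div_nonneg (truncate_mem_Ioo hε _).1.le (sub_nonneg.2 (truncate_mem_Ioo hε _).2.le)
  refine (lintegral_mono fun ω => ENNReal.ofReal_le_ofReal (hpt ω)).trans ?_
  rw [← ofReal_integral_eq_lintegral_ofReal hi (.of_forall fun ω => (hpos ω).trans (hpt ω)),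
    integral_sub (integrable_const _) (hZi.const_mul _), integral_const, integral_const_mul, ← hm]
  refine ENNReal.ofReal_le_ofReal ?_
  simp only [probReal_univ, smul_eq_mul, one_mul]
  have hk1 : (0 : ℝ) < k + 1 := by positivity
  have hk2 : (0 : ℝ) < k + 2 := by positivity
  have h6 : 1 / ((k : ℝ) + 1) ≤ m * x := by rwa [div_le_iff₀ hk1]
  -- The bound `8 * x ≤ m` lets half of the linear term absorb the quadratic one.
  have h7 : 1 + 16 * x ^ 2 - 4 * x * m ≤ 1 - 2 / ((k : ℝ) + 1) := by
    have : 2 / ((k : ℝ) + 1) = 2 * (1 / ((k : ℝ) + 1)) := by ring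
    nlinarith
  refine h7.trans ?_
  rw [div_pow, le_div_iff₀ (by positivity), sub_mul, div_mul_eq_mul_div, sub_le_iff_le_add,
    ← sub_le_iff_le_add', le_div_iff₀ hk1]
  nlinarith

/-- If the drift dominates `1 / k`, the products of the ratios of the transition probabilities are
almost surely summable. -/
lemma ae_summable_ratioProd {Z : ℕ → Ω → ℝ} (hZ : ∀ k, Measurable (Z k))
    (hZ1 : ∀ k ω, Z k ω ∈ Set.Icc (-1 : ℝ) 1) (hind : iIndepFun Z μ) {m : ℝ}
    (hm0 : 0 < m) (hm : ∀ k, m = ∫ ω, Z k ω ∂μ) {x : ℕ → ℝ} (hx0 : ∀ k, 0 ≤ x k)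
    (hx : Tendsto x atTop (𝓝 0)) (hlarge : ∀ᶠ k in atTop, 1 ≤ m * x k * (k + 1)) :
    ∀ᵐ ω ∂μ, Summable (ratioProd fun k => truncate ε (1 / 2 - Z k ω * x k)) := by
  obtain ⟨N, hN⟩ := eventually_atTop.1 ((
    (hx.eventually_le_const (show (0 : ℝ) < 1 / 4 by norm_num)).and
    (hx.eventually_le_const (show (0 : ℝ) < m / 8 by positivity))).and hlarge)
  have hT := (continuous_truncate hε).measurable
  set φ : ℕ → ℝ → ℝ≥0∞ := fun k z =>
    ENNReal.ofReal (truncate ε (1 / 2 - z * x k) / (1 - truncate ε (1 / 2 - z * x k))) with hφ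
  have hφm : ∀ k, Measurable (φ k) := by
    intro k
    have : Measurable fun z : ℝ => truncate ε (1 / 2 - z * x k) := hT.comp (by fun_prop)
    exact (this.div (measurable_const.sub this)).ennreal_ofReal
  have hφi : iIndepFun (fun k ω => φ (k + N) (Z (k + N) ω)) μ :=
    (hind.precomp (add_left_injective N)).comp (fun k => φ (k + N)) fun k => hφm _
  have hmeas : ∀ k, Measurable fun ω => φ (k + N) (Z (k + N) ω) := fun k => (hφm _).comp (hZ _)
  have hle : ∀ k, ∫⁻ ω, φ (k + N) (Z (k + N) ω) ∂μ
      ≤ ENNReal.ofReal ((((k + N : ℕ) + 1 : ℝ) / ((k + N : ℕ) + 2)) ^ 2) := by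
    intro k
    obtain ⟨⟨h1, h2⟩, h3⟩ := hN (k + N) (by omega)
    exact lintegral_ratio_le hε (hZ _) (hZ1 _) (hm _) (hx0 _) h1 (by linarith) h3
  -- The square in the bound for one factor is what makes the telescoped product summable.
  have htel : ∀ n, ∏ k ∈ Finset.range n, (((k + N : ℕ) + 1 : ℝ) / ((k + N : ℕ) + 2)) ^ 2
      = ((N : ℝ) + 1) ^ 2 * (1 / ((n + N + 1 : ℕ) : ℝ) ^ 2) := by
    intro n
    induction n with
    | zero => simp; field_simp
    | succ n ih =>
      rw [Finset.prod_range_succ, ih]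
      push_cast
      field_simp
      ring
  have hprod : ∀ n, ∫⁻ ω, ∏ k ∈ Finset.range n, φ (k + N) (Z (k + N) ω) ∂μ
      ≤ ENNReal.ofReal (((N : ℝ) + 1) ^ 2 * (1 / ((n + N + 1 : ℕ) : ℝ) ^ 2)) := by
    intro n
    have := lintegral_prod_eq_prod_lintegral_of_indepFun (Finset.range n) _ hφi hmeas
    rw [this, ← htel, ENNReal.ofReal_prod_of_nonneg fun k _ => by positivity]
    exact Finset.prod_le_prod' fun k _ => hle k
  have hsum : Summable fun n : ℕ => ((N : ℝ) + 1) ^ 2 * (1 / ((n + N + 1 : ℕ) : ℝ) ^ 2) :=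
    ((summable_nat_add_iff (f := fun n : ℕ => 1 / (n : ℝ) ^ 2) (N + 1)).2
      (Real.summable_one_div_nat_pow.2 one_lt_two)).mul_left _
  have hfin : ∫⁻ ω, ∑' n, ∏ k ∈ Finset.range n, φ (k + N) (Z (k + N) ω) ∂μ ≠ ∞ := by
    rw [lintegral_tsum fun n => (Finset.measurable_fun_prod _ fun k _ => hmeas k).aemeasurable]
    exact ne_top_of_le_ne_top hsum.tsum_ofReal_ne_top (ENNReal.tsum_le_tsum hprod)
  filter_upwards [ae_lt_top (.tsum fun n => Finset.measurable_fun_prod _ fun k _ => hmeas k) hfin]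
    with ω hω
  rw [← summable_ratioProd_shift_iff (fun k => truncate_mem_Ioo hε _) N,
    summable_iff_tsum_ofReal_ne_top fun n => (ratioProd_pos (fun k => truncate_mem_Ioo hε _) n).le]
  refine ne_of_lt (lt_of_eq_of_lt (tsum_congr fun n => ?_) hω)
  rw [ratioProd, ENNReal.ofReal_prod_of_nonneg]
  exact fun k _ => div_nonneg (truncate_mem_Ioo hε _).1.le
    (sub_nonneg.2 (truncate_mem_Ioo hε _).2.le)

/-- The set of sequences for which the products of the ratios of the transition probabilities are
summable. -/
def summableSet (ε : ℝ) (x : ℕ → ℝ) : Set (ℕ → ℝ) :=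
  {z | Summable (ratioProd fun k => truncate ε (1 / 2 + z k * x k))}

lemma measurableSet_summableSet (x : ℕ → ℝ) : MeasurableSet (summableSet ε x) := by
  have hT := (continuous_truncate hε).measurable
  have hm : ∀ n, Measurable fun z : ℕ → ℝ =>
      ratioProd (fun k => truncate ε (1 / 2 + z k * x k)) n := by
    intro n
    have h : ∀ k, Measurable fun z : ℕ → ℝ => truncate ε (1 / 2 + z k * x k) := fun k =>
      hT.comp (by fun_prop)
    exact Finset.measurable_fun_prod _ fun k _ => (h k).div (measurable_const.sub (h k))
  have : summableSet ε x = {z | ∑' n, ENNReal.ofReal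
      (ratioProd (fun k => truncate ε (1 / 2 + z k * x k)) n) = ∞}ᶜ := by
    ext z
    exact summable_iff_tsum_ofReal_ne_top
      fun n => (ratioProd_pos (fun k => truncate_mem_Ioo hε _) n).le
  rw [this]
  exact (measurableSet_eq_fun (Measurable.tsum fun n => (hm n).ennreal_ofReal)
    measurable_const).compl

lemma mem_summableSet_shift_iff (x z : ℕ → ℝ) (N : ℕ) :
    (fun k => z (k + N)) ∈ summableSet ε (fun k => x (k + N)) ↔ z ∈ summableSet ε x :=
  summable_ratioProd_shift_iff (P := fun k => truncate ε (1 / 2 + z k * x k))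
    (fun _ => truncate_mem_Ioo hε _) N

lemma neg_mem_summableSet_iff (x z : ℕ → ℝ) :
    (fun k => -z k) ∈ summableSet ε x ↔
      Summable fun n => (ratioProd (fun k => truncate ε (1 / 2 + z k * x k)) n)⁻¹ := by
  simp only [← ratioProd_one_sub, ← truncate_half_sub hε, sub_eq_add_neg, ← neg_mul]
  exact Iff.rfl

omit [IsProbabilityMeasure μ] in
-- Dropping the first `N` factors does not affect summability, so the event lies in the tail
-- σ-algebra.
lemma measure_summableSet_zero_or_one {Z : ℕ → Ω → ℝ} (hZ : ∀ k, Measurable (Z k))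
    (hind : iIndepFun Z μ) (x : ℕ → ℝ) :
    μ {ω | (fun k => Z k ω) ∈ summableSet ε x} = 0 ∨
      μ {ω | (fun k => Z k ω) ∈ summableSet ε x} = 1 := by
  refine measure_zero_or_one_of_measurableSet_limsup_atTop (fun k => (hZ k).comap_le)
    hind.iIndep ?_
  rw [limsup_eq_iInf_iSup_of_nat, MeasurableSpace.measurableSet_iInf]
  intro N
  have h : {ω | (fun k => Z k ω) ∈ summableSet ε x}
      = (fun ω k => Z (k + N) ω) ⁻¹' summableSet ε (fun k => x (k + N)) := by
    ext ω
    exact (mem_summableSet_shift_iff hε x (fun k => Z k ω) N).symm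
  rw [h]
  -- Measurability is meant for the σ-algebra generated by the variables of index at least `N`, not
  -- for the ambient one on `Ω`.
  refine (@measurable_pi_iff _ _ _ (_) _ _).2 (fun k => ?_) (measurableSet_summableSet hε _)
  refine Measurable.mono (comap_measurable (Z (k + N))) ?_ le_rfl
  exact le_iSup₂_of_le (k + N) (by omega) le_rfl

/-- In a symmetric environment neither the products of the ratios nor their inverses are
summable. -/
lemma ae_not_summable_ratioProd {Z : ℕ → Ω → ℝ} (hZ : ∀ k, Measurable (Z k))
    (hind : iIndepFun Z μ) (hsymm : ∀ k, IdentDistrib (Z k) (fun ω => -Z k ω) μ μ) (x : ℕ → ℝ) :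
    ∀ᵐ ω ∂μ, ¬ Summable (ratioProd fun k => truncate ε (1 / 2 + Z k ω * x k)) ∧
      ¬ Summable fun n => (ratioProd (fun k => truncate ε (1 / 2 + Z k ω * x k)) n)⁻¹ := by
  have hind' : iIndepFun (fun k ω => -Z k ω) μ :=
    hind.comp (fun _ z => -z) fun _ => measurable_neg
  have hmap : μ.map (fun ω k => Z k ω) = μ.map (fun ω k => -Z k ω) := by
    rw [hind.map_fun_eq_infinitePi_map hZ,
      hind'.map_fun_eq_infinitePi_map (X := fun k ω => -Z k ω) fun k => (hZ k).neg]
    congr 1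
    funext k
    exact (hsymm k).map_eq
  have hA := measurableSet_summableSet hε x
  set A := {ω | (fun k => Z k ω) ∈ summableSet ε x} with hAdef
  set A' := {ω | (fun k => -Z k ω) ∈ summableSet ε x} with hAdef'
  have hneg : Measurable fun ω k => -Z k ω := measurable_pi_lambda _ fun k => (hZ k).neg
  have hmA' : MeasurableSet A' := hneg hA
  have heq : μ A = μ A' := by
    have h := congrArg (fun ν => ν (summableSet ε x)) hmap
    rwa [Measure.map_apply (measurable_pi_lambda _ hZ) hA,
      Measure.map_apply hneg hA] at h
  -- The products and their inverses cannot both tend to `0`.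
  have hdisj : Disjoint A A' := by
    rw [Set.disjoint_left]
    intro ω h1 h2
    have h2 := (neg_mem_summableSet_iff hε x (fun k => Z k ω)).1 h2
    have h1 : Summable (ratioProd fun k => truncate ε (1 / 2 + Z k ω * x k)) := h1
    have h3 := h1.tendsto_atTop_zero.mul h2.tendsto_atTop_zero
    rw [mul_zero] at h3
    refine one_ne_zero (tendsto_nhds_unique (tendsto_const_nhds (x := (1 : ℝ))) (h3.congr fun n => ?_))
    exact mul_inv_cancel₀ (ratioProd_pos (fun k => truncate_mem_Ioo hε _) n).ne'
  have hzero : μ A = 0 := by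
    refine (measure_summableSet_zero_or_one hε hZ hind x).resolve_right fun h => ?_
    have h1 : μ (A ∪ A') ≤ 1 := prob_le_one
    rw [measure_union hdisj hmA', ← heq] at h1
    change μ A = 1 at h
    rw [h] at h1
    norm_num at h1
  have h1 : ∀ᵐ ω ∂μ, ω ∉ A := measure_eq_zero_iff_ae_notMem.1 hzero
  have h2 : ∀ᵐ ω ∂μ, ω ∉ A' := measure_eq_zero_iff_ae_notMem.1 (heq ▸ hzero)
  filter_upwards [h1, h2] with ω h1 h2
  exact ⟨h1, fun h => h2 ((neg_mem_summableSet_iff hε x (fun k => Z k ω)).2 h)⟩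

end Random

/-! ### The four regimes of the theorem -/

lemma downProb_environment {ε : ℝ} (hε : ε ∈ Set.Ioo (0 : ℝ) (1 / 2)) (χ : ℝ≥0 → ℝ≥0)
    {ξ Y : ℕ+ → ℝ} {c : ℝ} (hξ : ∀ n, ξ n = c) :
    downProb (environment hε χ ξ Y)
      = fun k => truncate ε (c + Y k.succPNat * χ ((k + 1 : ℕ) : ℝ≥0)) := by
  funext k
  simp only [downProb, environment, hξ, Nat.succPNat_coe, Nat.succ_eq_add_one]

lemma tendsto_atTop_mul_rpow_neg {a β : ℝ} (ha : 0 < a) (hβ : β < 1) :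
    Tendsto (fun k : ℕ => a * ((k + 1 : ℕ) : ℝ) ^ (-β) * (k + 1)) atTop atTop := by
  have h1 : Tendsto (fun k : ℕ => ((k + 1 : ℕ) : ℝ) ^ (1 - β)) atTop atTop :=
    ((tendsto_rpow_atTop (sub_pos.2 hβ)).comp tendsto_natCast_atTop_atTop).comp
      (tendsto_add_atTop_nat 1)
  refine (h1.const_mul_atTop ha).congr fun k => ?_
  have h2 : (0 : ℝ) < ((k + 1 : ℕ) : ℝ) := by positivity
  rw [sub_eq_neg_add, Real.rpow_add_one h2.ne', mul_assoc]
  push_cast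
  rfl

end RWRE

end

theorem mainTheorem4
    {Ω : Type*} [MeasurableSpace Ω] (μ : Measure Ω) [IsProbabilityMeasure μ]
    (ε : ℝ) (hε : ε ∈ Set.Ioo (0 : ℝ) (1 / 2))
    (χ : ℝ≥0 → ℝ≥0) (hχ : Tendsto χ atTop (𝓝 0))
    (ξ Y : ℕ+ → Ω → ℝ)
    (hξ_meas : ∀ n, Measurable (ξ n)) (hY_meas : ∀ n, Measurable (Y n))
    (hξ_indep : iIndepFun ξ μ) (hξ_ident : ∀ n, IdentDistrib (ξ n) (ξ 1) μ μ)
    (hξ_elliptic : ∀ᵐ ω ∂μ, ξ 1 ω ∈ Set.Icc ε (1 - ε))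
    (hY_indep : iIndepFun Y μ) (hY_ident : ∀ n, IdentDistrib (Y n) (Y 1) μ μ)
    (hY_bdd : ∀ n ω, Y n ω ∈ Set.Icc (-1 : ℝ) 1)
    (hYξ_indep : ∀ S T : Finset ℕ+, Disjoint S T →
      IndepFun (fun ω (i : S) => Y i ω) (fun ω (j : T) => ξ j ω) μ)
    (c : ℝ) (hc : c ∈ Set.Ioo (0 : ℝ) 1) (hξc : ∀ᵐ ω ∂μ, ξ 1 ω = c)
    (hY_var : 0 < Var[Y 1; μ]) :
    -- (i)
    (c < 1 / 2 →
      ∀ᵐ ω ∂μ, RWRE.IsTransient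
        (RWRE.walkKernel (RWRE.environment hε χ (fun n => ξ n ω) (fun n => Y n ω)))) ∧
    -- (ii)
    (1 / 2 < c →
      ∀ᵐ ω ∂μ, RWRE.IsErgodic
        (RWRE.walkKernel (RWRE.environment hε χ (fun n => ξ n ω) (fun n => Y n ω)))) ∧
    -- (iii)
    (c = 1 / 2 → IdentDistrib (Y 1) (fun ω => -Y 1 ω) μ μ →
      ∀ᵐ ω ∂μ, RWRE.IsNullRecurrent
        (RWRE.walkKernel (RWRE.environment hε χ (fun n => ξ n ω) (fun n => Y n ω)))) ∧
    -- (iv)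
    (c = 1 / 2 → ∫ ω, Y 1 ω ∂μ ≠ 0 →
      ∀ a β : ℝ, 0 < a → 0 < β → (∀ n : ℕ+, (χ (n : ℕ) : ℝ) = a * ((n : ℕ) : ℝ) ^ (-β)) →
        (β < 1 → 0 < ∫ ω, Y 1 ω ∂μ →
          ∀ᵐ ω ∂μ, RWRE.IsErgodic
            (RWRE.walkKernel (RWRE.environment hε χ (fun n => ξ n ω) (fun n => Y n ω)))) ∧
        (1 < β →
          ∀ᵐ ω ∂μ, RWRE.IsNullRecurrent
            (RWRE.walkKernel (RWRE.environment hε χ (fun n => ξ n ω) (fun n => Y n ω)))) ∧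
        (β < 1 → ∫ ω, Y 1 ω ∂μ < 0 →
          ∀ᵐ ω ∂μ, RWRE.IsTransient
            (RWRE.walkKernel (RWRE.environment hε χ (fun n => ξ n ω) (fun n => Y n ω))))) := by

  have hξ_all : ∀ᵐ ω ∂μ, ∀ n, ξ n ω = c :=
    ae_all_iff.2 fun n => (hξ_ident n).symm.ae_snd (p := fun z => z = c) (measurableSet_singleton c)
      hξc
  have hcε : c ∈ Set.Icc ε (1 - ε) := by
    obtain ⟨ω, h1, h2⟩ := (hξ_elliptic.and hξc).exists
    exact h2 ▸ h1
  -- Index `k` stands for the state `k + 1`, here and in `Z`.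
  set x : ℕ → ℝ := fun k => χ ((k + 1 : ℕ) : ℝ≥0) with hx_def
  have hx : Tendsto x atTop (𝓝 0) :=
    NNReal.tendsto_coe.2 ((hχ.comp tendsto_natCast_atTop_atTop).comp (tendsto_add_atTop_nat 1))
  have hx0 : ∀ k, 0 ≤ x k := fun k => NNReal.coe_nonneg _
  set Z : ℕ → Ω → ℝ := fun k => Y k.succPNat with hZ_def
  have hZ : ∀ k, Measurable (Z k) := fun k => hY_meas _
  have hZ1 : ∀ k ω, Z k ω ∈ Set.Icc (-1 : ℝ) 1 := fun k ω => hY_bdd _ ω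
  have hind : iIndepFun Z μ := hY_indep.precomp Nat.succPNat_injective
  have hP : ∀ (d : ℝ) (k : ℕ) ω, RWRE.truncate ε (d + Z k ω * x k) ∈ Set.Ioo (0 : ℝ) 1 :=
    fun d k ω => RWRE.truncate_mem_Ioo hε _
  have htransient : (∀ᵐ ω ∂μ, Summable (RWRE.ratioProd fun k =>
      RWRE.truncate ε (c + Z k ω * x k))) → ∀ᵐ ω ∂μ, RWRE.IsTransient
        (RWRE.walkKernel (RWRE.environment hε χ (fun n => ξ n ω) (fun n => Y n ω))) := by
    intro h
    filter_upwards [h, hξ_all] with ω h1 h2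
    have h3 := RWRE.downProb_environment hε χ (Y := fun n => Y n ω) h2
    exact RWRE.isTransient_walkKernel (h3 ▸ fun k => hP c k ω) (h3 ▸ h1)
  have hergodic : (∀ᵐ ω ∂μ, Summable fun n => (RWRE.ratioProd (fun k =>
      RWRE.truncate ε (c + Z k ω * x k)) n)⁻¹) → ∀ᵐ ω ∂μ, RWRE.IsErgodic
        (RWRE.walkKernel (RWRE.environment hε χ (fun n => ξ n ω) (fun n => Y n ω))) := by
    intro h
    filter_upwards [h, hξ_all] with ω h1 h2
    have h3 := RWRE.downProb_environment hε χ (Y := fun n => Y n ω) h2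
    exact RWRE.isErgodic_walkKernel (h3 ▸ fun k => hP c k ω) (h3 ▸ h1)
  have hnull : (∀ᵐ ω ∂μ, ¬ Summable (RWRE.ratioProd fun k =>
      RWRE.truncate ε (c + Z k ω * x k)) ∧ ¬ Summable fun n => (RWRE.ratioProd (fun k =>
      RWRE.truncate ε (c + Z k ω * x k)) n)⁻¹) → ∀ᵐ ω ∂μ, RWRE.IsNullRecurrent
        (RWRE.walkKernel (RWRE.environment hε χ (fun n => ξ n ω) (fun n => Y n ω))) := by
    intro h
    filter_upwards [h, hξ_all] with ω h1 h2
    have h3 := RWRE.downProb_environment hε χ (Y := fun n => Y n ω) h2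
    exact RWRE.isNullRecurrent_walkKernel (h3 ▸ fun k => hP c k ω) (h3 ▸ h1.1) (h3 ▸ h1.2)
  have hlim : ∀ ω, Tendsto (fun k => RWRE.truncate ε (c + Z k ω * x k)) atTop (𝓝 c) := fun ω =>
    RWRE.tendsto_truncate hε hcε (fun k => hZ1 k ω) hx
  refine ⟨fun h => htransient (.of_forall fun ω => ?_), fun h => hergodic (.of_forall fun ω => ?_),
    fun h hsymm => hnull ?_, fun h hmean a β ha hβ hχa => ?_⟩
  · exact RWRE.summable_ratioProd_of_tendsto (fun k => hP c k ω) h (hlim ω)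
  · simp only [← RWRE.ratioProd_one_sub]
    exact RWRE.summable_ratioProd_of_tendsto
      (fun k => ⟨sub_pos.2 (hP c k ω).2, sub_lt_self _ (hP c k ω).1⟩) (l := 1 - c) (by linarith)
      ((hlim ω).const_sub 1)
  · rw [h]
    refine RWRE.ae_not_summable_ratioProd hε hZ hind (fun k => ?_) x
    exact ((hY_ident _).trans hsymm).trans ((hY_ident _).symm.comp measurable_neg)
  have hxa : ∀ k, x k = a * ((k + 1 : ℕ) : ℝ) ^ (-β) := fun k => hχa k.succPNat
  have hlarge : β < 1 → ∀ m : ℝ, 0 < m → ∀ᶠ k : ℕ in atTop, 1 ≤ m * x k * (k + 1) := by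
    intro hβ1 m hm
    have := (RWRE.tendsto_atTop_mul_rpow_neg (mul_pos hm ha) hβ1).eventually_ge_atTop 1
    simpa only [hxa, mul_assoc] using this
  rw [h] at htransient hergodic hnull
  refine ⟨fun hβ1 hm => hergodic ?_, fun hβ1 => hnull (.of_forall fun ω => ?_),
    fun hβ1 hm => htransient ?_⟩
  -- Inverting the products reflects the environment about `1 / 2`, so the positive mean of `Y 1`
  -- now makes the reflected ratios small.
  · simp only [← RWRE.ratioProd_one_sub, ← RWRE.truncate_half_sub hε]
    exact RWRE.ae_summable_ratioProd hε hZ hZ1 hind hm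
      (fun k => (hY_ident _).integral_eq.symm) hx0 hx (hlarge hβ1 _ hm)
  · have hxs : Summable x := by
      simp only [funext hxa]
      exact ((summable_nat_add_iff (f := fun n : ℕ => (n : ℝ) ^ (-β)) 1).2
        (Real.summable_nat_rpow.2 (by linarith))).mul_left a
    have hle : ∀ (z : ℝ) (k : ℕ), z ∈ Set.Icc (-1 : ℝ) 1 →
        1 / 2 - x k ≤ RWRE.truncate ε (1 / 2 + z * x k) := by
      intro z k hz
      refine le_trans (sub_le_sub_left ?_ _) (RWRE.half_sub_abs_le_truncate hε _)
      rw [abs_mul, abs_of_nonneg (hx0 k)]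
      exact mul_le_of_le_one_left (hx0 k) (abs_le.2 hz)
    constructor
    · exact RWRE.not_summable_ratioProd (half_pos hε.1) (fun k => RWRE.truncate_mem hε _) hxs
        fun k => hle _ k (hZ1 k ω)
    · simp only [← RWRE.ratioProd_one_sub, ← RWRE.truncate_half_sub hε, sub_eq_add_neg, ← neg_mul]
      exact RWRE.not_summable_ratioProd (half_pos hε.1) (fun k => RWRE.truncate_mem hε _) hxs
        fun k => hle _ k ⟨neg_le_neg (hZ1 k ω).2, by linarith [(hZ1 k ω).1]⟩
  -- The negated variables have positive mean, and the two minus signs cancel.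
  · have := RWRE.ae_summable_ratioProd hε (Z := fun k ω => -Z k ω) (m := -∫ ω, Y 1 ω ∂μ)
      (fun k => (hZ k).neg) (fun k ω => ⟨neg_le_neg (hZ1 k ω).2, by linarith [(hZ1 k ω).1]⟩)
      (hind.comp (fun _ z => -z) fun _ => measurable_neg) (by linarith)
      (fun k => by rw [integral_neg]; exact congrArg _ (hY_ident _).integral_eq.symm)
      hx0 hx (hlarge hβ1 _ (by linarith))
    simpa only [neg_mul, sub_neg_eq_add] using this
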